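/- **Setting.** Let $M$ be $\mathbb R^2$ or a closed connected oriented surface of genus at least $1$, with a symplectic form $\omega$, and let $\varphi$ be a symplectomorphism of $(M,\omega)$ with a hyperbolic fixed point $x$, whose stable and unstable manifolds $W^s,W^u$ (injectively immersed lines) intersect transversely and strongly (each component of $W^s\setminus\{x\}$ meets each component of $W^u\setminus\{x\}$), and which preserves the orientations of $W^s$ and of $W^u$. Fix an orientation of $W^u$. A point $p\in W^s\cap W^u$ is a contractible homoclinic point if the loop running from $x$ to $p$ in $W^u$ and from $p$ back to $x$ in $W^s$ is null-homotopic in $M$; let $\mathcal H_{[x]}$ be the set of these points and $\mu:\mathcal H_{[x]}\to\mathbb Z$, $\mu(p)=\mu(p,x)$, the grading by the relative Maslov index. For $p,q\in\mathcal H_{[x]}$ with $\mu(q)=\mu(p)-1$ let $n(p,q)\in\{0,\pm1\}$ be $0$ if there is no smooth orientation preserving immersed di-gon (lens with two convex vertices, immersed up to the boundary and the vertices) from its left vertex at $p$ to its right vertex at $q$, with lower boundary in $W^u$ and upper boundary in $W^s$; otherwise let it be $+1$ if the segment of $W^u$ directed from $p$ to $q$ is positively oriented, and $-1$ if not. For a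 finite set $E\subseteq\mathcal H_{[x]}$ let $E_k=\{p\in E\mid\mu(p)=k\}$, and let $\partial^E:\mathbb ZE\to\mathbb ZE$ be the linear map on the free abelian group $\mathbb ZE$ with $$\partial^E p=\sum_{q\in E,\ \mu(q)=\mu(p)-1}n(p,q)\,q\qquad(p\in E),$$ with components $\partial^E_k:\mathbb ZE_k\to\mathbb ZE_{k-1}$. The set $E$ is $\partial$-complete if $\partial^E\circ\partial^E=0$. For finite $D\subseteq E$ let $\mathcal I^{DE}:\mathbb ZD\to\mathbb ZE$ be the inclusion, with components $\mathcal I^{DE}_k:\mathbb ZD_k\to\mathbb ZE_k$, and let $\partial^{E_{E\setminus D}}:\mathbb ZE\to\mathbb ZE$ be the linear map with $$\partial^{E_{E\setminus D}}p=\sum_{q\in E\setminus D,\ \mu(q)=\mu(p)-1}n(p,q)\,q\qquad(p\in E).$$ For $\partial$-complete $D\subseteq E$, the pair $(D,E)$ is chain compatible if $\mathcal I^{DE}_{k-1}\circ\partial^D_k=\partial^E_k\circ\mathcal I^{DE}_k$ for all $k\in\mathbb Z$. **Lemma (criterion for chain compatibility).** Let $D\subseteq E$ be $\partial$-complete finite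 subsets of $\mathcal H_{[x]}$. Then $$(D,E)\text{ is chain compatible}\iff\partial^{E_{E\setminus D}}\circ\mathcal I^{DE}=0,$$ that is, if and only if $\partial^{E_{E\setminus D}}$ vanishes on $D$. Equivalently, $(D,E)$ is chain compatible if and only if there are no $p\in D$ and $q\in E\setminus D$ with $\mu(q)=\mu(p)-1$ and $n(p,q)\neq0$. -/

import Mathlib

open Filter Topology Bundle
open scoped Manifold ContDiff unitInterval

universe w

noncomputable section

namespace HomFloer

/-- The Euclidean plane. -/
abbrev Plane : Type := EuclideanSpace ℝ (Fin 2)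

section Surface

variable (M : Type w) [TopologicalSpace M] [ChartedSpace Plane M]

/-- The genus of a closed connected oriented surface: half of its first Betti number, the rank of
the singular homology group `H₁(M; ℤ)`. -/
def genus : ℕ :=
  Module.finrank ℤ
    (((AlgebraicTopology.singularHomologyFunctor (ModuleCat.{w} ℤ) 1).obj
      (ModuleCat.of ℤ (ULift.{w} ℤ))).obj (TopCat.of M)) / 2

/-- The surface is (diffeomorphic to) the plane, or it is closed and connected of genus at least
one. Orientability is not mentioned, because a symplectic form orients the surface. -/
def IsPlaneOrClosedSurface : Prop :=
  Nonempty (M ≃ₘ⟮𝓡 2, 𝓡 2⟯ Plane) ∨ (CompactSpace M ∧ ConnectedSpace M ∧ 1 ≤ genus M)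

variable [IsManifold (𝓡 2) ∞ M]

/-- A symplectic form on a surface: a smooth nondegenerate alternating two-form. Every two-form on
a two-dimensional manifold is closed, so closedness imposes no condition. -/
structure SymplecticForm where
  toFun (y : M) : TangentSpace (𝓡 2) y →L[ℝ] TangentSpace (𝓡 2) y →L[ℝ] ℝ
  alternating (y : M) (v : TangentSpace (𝓡 2) y) : toFun y v v = 0
  nondegenerate (y : M) (v : TangentSpace (𝓡 2) y) : (∀ w, toFun y v w = 0) → v = 0
  smooth : ContMDiff (𝓡 2) ((𝓡 2).prod 𝓘(ℝ, Plane →L[ℝ] Plane →L[ℝ] ℝ)) ∞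
    (fun y ↦ TotalSpace.mk' (Plane →L[ℝ] Plane →L[ℝ] ℝ)
      (E := fun y : M ↦ TangentSpace (𝓡 2) y →L[ℝ] TangentSpace (𝓡 2) y →L[ℝ] ℝ) y (toFun y))

end Surface

section StableManifold

/-! Stable manifolds. The unstable manifold of `φ` at `x` is the stable manifold of `φ⁻¹` at `x`,
so everything is said for the stable manifold of a map `ψ`, to be used with `ψ = φ` and with
`ψ = φ⁻¹`. -/

variable {M : Type*} [TopologicalSpace M]

/-- The stable manifold `{y | ψⁿ(y) → x as n → ∞}` as a set. -/
def stableSet (ψ : M → M) (x : M) : Set M :=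
  {y | Tendsto (fun n : ℕ ↦ ψ^[n] y) atTop (𝓝 x)}

/-- A path in the stable manifold, the latter with its topology of an injectively immersed line
(and not with the subspace topology). For a hyperbolic fixed point `x` these are exactly the
continuous paths in `M` that the iterates of `ψ` contract to `x` uniformly: a compact piece of the
immersed line is carried by some iterate into the local stable manifold, which is embedded. -/
def IsLeafPath (ψ : M → M) (x : M) (c : I → M) : Prop :=
  Continuous c ∧ ∀ U ∈ 𝓝 x, ∀ᶠ n : ℕ in atTop, ∀ t, ψ^[n] (c t) ∈ U

/-- `y` and `z` lie on the same branch, that is, in the same component of the stable manifold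
(as an immersed line) minus `x`. -/
def SameBranch (ψ : M → M) (x y z : M) : Prop :=
  ∃ c : I → M, IsLeafPath ψ x c ∧ c 0 = y ∧ c 1 = z ∧ ∀ t, c t ≠ x

/-- An orientation of the immersed line: one of the two linear orders of its points for which every
simple path in the line runs monotonically. `lt y z` says that the segment directed from `y` to
`z` is positively oriented. -/
structure LeafOrientation (ψ : M → M) (x : M) where
  lt : stableSet ψ x → stableSet ψ x → Prop
  isStrictTotalOrder : IsStrictTotalOrder (stableSet ψ x) lt
  monotone : ∀ c : I → stableSet ψ x, IsLeafPath ψ x (fun t ↦ (c t : M)) →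
    Function.Injective c →
    (∀ s t, s < t → lt (c s) (c t)) ∨ (∀ s t, s < t → lt (c t) (c s))

/-- `ψ` (equivalently `ψ⁻¹`) preserves the orientations of the stable manifold. -/
def PreservesLeafOrientation (ψ : M → M) (x : M) : Prop :=
  ∀ (o : LeafOrientation ψ x) (y z y' z' : stableSet ψ x),
    (y' : M) = ψ y → (z' : M) = ψ z → o.lt y z → o.lt y' z'

variable [ChartedSpace Plane M]

/-- The tangent vector `w` of `M` is tangent to the stable manifold at its base point: it is the
velocity at time `0` of a smooth curve that runs near time `0` in the immersed line. -/
def IsLeafTangent (ψ : M → M) (x : M) (w : TangentBundle (𝓡 2) M) : Prop :=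
  ∃ c : ℝ → M, ContMDiff 𝓘(ℝ, ℝ) (𝓡 2) ∞ c ∧
    (∀ U ∈ 𝓝 x, ∀ᶠ n : ℕ in atTop, ∀ t ∈ Set.Icc (-1 : ℝ) 1, ψ^[n] (c t) ∈ U) ∧
    tangentMap 𝓘(ℝ, ℝ) (𝓡 2) c ⟨0, (1 : ℝ)⟩ = w

end StableManifold

variable {M : Type*} [TopologicalSpace M] [ChartedSpace Plane M] [IsManifold (𝓡 2) ∞ M]

variable (M) in
/-- A symplectomorphism `φ` of a symplectic surface with a hyperbolic fixed point `x` whose stable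
and unstable manifolds intersect strongly and transversely; `φ` preserves the orientations of both
of them, and an orientation of the unstable manifold is chosen. -/
structure HomoclinicTangle where
  /-- the symplectic form -/
  form : SymplecticForm M
  /-- the symplectomorphism -/
  φ : M ≃ₘ⟮𝓡 2, 𝓡 2⟯ M
  symplectic : ∀ (y : M) (v w : TangentSpace (𝓡 2) y),
    form.toFun (φ y) (mfderiv (𝓡 2) (𝓡 2) φ y v) (mfderiv (𝓡 2) (𝓡 2) φ y w) = form.toFun y v w
  /-- the fixed point -/
  x : M
  fixed : φ x = x
  /-- No complex eigenvalue of `Dφ(x)` has modulus one. Since `φ x = x`, the source and the target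
  of `mfderiv φ x` are the same tangent space, identified with the plane by the same chart. -/
  hyperbolic : ∀ z : ℂ, Polynomial.aeval z
    (LinearMap.charpoly (R := ℝ) (M := Plane) (mfderiv (𝓡 2) (𝓡 2) φ x).toLinearMap) = 0 → ‖z‖ ≠ 1
  /-- At every homoclinic point the two tangent lines span the tangent plane. -/
  transverse : ∀ y ∈ stableSet φ x ∩ stableSet φ.symm x,
    Submodule.span ℝ ({v : TangentSpace (𝓡 2) y | IsLeafTangent φ x ⟨y, v⟩} ∪
      {v | IsLeafTangent φ.symm x ⟨y, v⟩}) = ⊤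
  /-- Every branch of the stable manifold meets every branch of the unstable manifold. -/
  strong : ∀ y ∈ stableSet φ x, y ≠ x → ∀ z ∈ stableSet φ.symm x, z ≠ x →
    ∃ q, SameBranch φ x y q ∧ SameBranch φ.symm x z q
  preserves_stable : PreservesLeafOrientation φ x
  preserves_unstable : PreservesLeafOrientation φ.symm x
  /-- the chosen orientation of the unstable manifold -/
  o : LeafOrientation φ.symm x

namespace HomoclinicTangle

variable (T : HomoclinicTangle M)

/-- The stable manifold. -/
def Ws : Set M := stableSet T.φ T.x

/-- The unstable manifold. -/
def Wu : Set M := stableSet T.φ.symm T.x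

/-- The homoclinic points, the fixed point included. -/
def homoclinic : Set M := T.Ws ∩ T.Wu

/-- The contractible homoclinic points: the loop that runs from `x` to `p` in the unstable manifold
and back from `p` to `x` in the stable manifold is null-homotopic. -/
def contractible : Set M :=
  {p | p ∈ T.homoclinic ∧ ∃ (a : Path T.x p) (b : Path p T.x),
    IsLeafPath T.φ.symm T.x a ∧ IsLeafPath T.φ T.x b ∧ (a.trans b).Homotopic (Path.refl T.x)}

/-- `m` is the relative Maslov index of `p` and `q`. Here `u` is a homotopy with endpoints `p` and
`q` fixed, from a path from `p` to `q` in the unstable manifold (`u (s, 0)`) to such a path in the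
stable manifold (`u (s, 1)`); `(a, b)` is a positively oriented frame of the pulled back tangent
bundle, constant on the two edges that `u` collapses to `p` and to `q`; `α` and `β` are the angles,
in this frame, of the tangent lines of the unstable and of the stable manifold along the two paths.
The index is the number of half turns of the first line relative to the second, closed up by turning
within the complement of the second line at both endpoints. If the intersections at `p` and `q` are
perpendicular in the frame, it is `((α 1 - β 1) - (α 0 - β 0)) / π`, twice the winding number of the
unit tangent vector along the loop, with a turn by `π/2` at `q` and one by `-π/2` at `p`. -/
def IsMaslovIndex (p q : M) (m : ℤ) : Prop :=
  ∃ (u : I × I → M) (a b : ∀ z, TangentSpace (𝓡 2) (u z)) (α β : I → ℝ),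
    IsLeafPath T.φ.symm T.x (fun s ↦ u (s, 0)) ∧ IsLeafPath T.φ T.x (fun s ↦ u (s, 1)) ∧
    (∀ t, u (0, t) = p) ∧ (∀ t, u (1, t) = q) ∧
    Continuous (fun z ↦ (⟨u z, a z⟩ : TangentBundle (𝓡 2) M)) ∧
    Continuous (fun z ↦ (⟨u z, b z⟩ : TangentBundle (𝓡 2) M)) ∧
    (∀ z, 0 < T.form.toFun (u z) (a z) (b z)) ∧
    (∀ e : I, e = 0 ∨ e = 1 → ∀ t,
      (⟨u (e, t), a (e, t)⟩ : TangentBundle (𝓡 2) M) = ⟨u (e, 0), a (e, 0)⟩ ∧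
      (⟨u (e, t), b (e, t)⟩ : TangentBundle (𝓡 2) M) = ⟨u (e, 0), b (e, 0)⟩) ∧
    Continuous α ∧ Continuous β ∧
    (∀ s, IsLeafTangent T.φ.symm T.x
      ⟨u (s, 0), Real.cos (α s) • a (s, 0) + Real.sin (α s) • b (s, 0)⟩) ∧
    (∀ s, IsLeafTangent T.φ T.x
      ⟨u (s, 1), Real.cos (β s) • a (s, 1) + Real.sin (β s) • b (s, 1)⟩) ∧
    m = ⌊(α 1 - β 1) / Real.pi⌋ - ⌊(α 0 - β 0) / Real.pi⌋

open Classical in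
/-- The Maslov grading `μ(p) = μ(p, x)` of the contractible homoclinic points. -/
def maslov (p : T.contractible) : ℤ :=
  if h : ∃ m, T.IsMaslovIndex p T.x m then h.choose else 0

end HomoclinicTangle

/-- The standard di-gon: a lens with two convex vertices, at `(-1, 0)` and `(1, 0)`. -/
def digon : Set Plane := {z | |z 1| ≤ 1 - z 0 ^ 2}

/-- The upper boundary of the di-gon. -/
def digonUpper : Set Plane := {z ∈ digon | z 1 = 1 - z 0 ^ 2}

/-- The lower boundary of the di-gon. -/
def digonLower : Set Plane := {z ∈ digon | z 1 = -(1 - z 0 ^ 2)}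

namespace HomoclinicTangle

variable (T : HomoclinicTangle M)

/-- `v` restricts to a smooth orientation preserving immersed di-gon from `p` to `q`; immersed also
at the boundary and at the vertices, smooth up to the boundary in the sense that `v` is smooth on an
open set around the di-gon. -/
def IsImmersedDigon (p q : M) (v : Plane → M) : Prop :=
  (∃ U : Set Plane, IsOpen U ∧ digon ⊆ U ∧ ContMDiffOn (𝓡 2) (𝓡 2) ∞ v U) ∧
  (∀ z ∈ digon, 0 < T.form.toFun (v z)
    (mfderiv (𝓡 2) (𝓡 2) v z (EuclideanSpace.single 0 1 : Plane))
    (mfderiv (𝓡 2) (𝓡 2) v z (EuclideanSpace.single 1 1 : Plane))) ∧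
  v '' digonLower ⊆ T.Wu ∧ v '' digonUpper ⊆ T.Ws ∧
  v !₂[-1, 0] = p ∧ v !₂[1, 0] = q

/-- The space of immersed di-gons from `p` to `q`. -/
def digons (p q : M) : Set (digon → M) :=
  {w | ∃ v, T.IsImmersedDigon p q v ∧ w = fun z : digon ↦ v z}

open Classical in
/-- The sign `n(p, q)`: zero if there is no immersed di-gon from `p` to `q`, and otherwise `1` or
`-1` according to whether the segment of the unstable manifold directed from `p` to `q` is
positively oriented or not. (The space of unparametrized di-gons is a quotient of `digons p q`, so
one is empty if and only if the other is.) -/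
def sign (p q : T.contractible) : ℤ :=
  if (T.digons p q).Nonempty then
    if T.o.lt ⟨p, p.2.1.2⟩ ⟨q, q.2.1.2⟩ then 1 else -1
  else 0

/-! Chain groups and boundary operators. A finite set of contractible homoclinic points is a
`Finset T.contractible`; the free abelian group on such a set `E` is `E →₀ ℤ`. -/

variable {T}

/-- The points of `E` of degree `k`. -/
def level (E : Finset T.contractible) (k : ℤ) : Finset T.contractible :=
  E.filter (fun p ↦ T.maslov p = k)

theorem level_mono {D E : Finset T.contractible} (h : D ⊆ E) (k : ℤ) : level D k ⊆ level E k :=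
  Finset.filter_subset_filter _ h

open Classical in
/-- The part of the boundary operator of `E` that lands in `F`: the linear map of `ℤE` that sends a
generator `p` to the sum of `n(p, q) q` over all `q ∈ E ∩ F` with `μ(q) = μ(p) - 1`. -/
def boundaryPart (E : Finset T.contractible) (F : Set T.contractible) :
    (E →₀ ℤ) →ₗ[ℤ] (E →₀ ℤ) :=
  Finsupp.linearCombination ℤ (fun p : E ↦
    ∑ q ∈ Finset.univ.filter (fun q : E ↦ q.1 ∈ F ∧ T.maslov q.1 = T.maslov p.1 - 1),
      Finsupp.single q (T.sign p.1 q.1))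

/-- The boundary operator of `E`: the linear map of `ℤE` that sends a generator `p` to the sum of
`n(p, q) q` over all `q ∈ E` with `μ(q) = μ(p) - 1`. -/
def boundary (E : Finset T.contractible) : (E →₀ ℤ) →ₗ[ℤ] (E →₀ ℤ) :=
  Finsupp.linearCombination ℤ (fun p : E ↦
    ∑ q ∈ Finset.univ.filter (fun q : E ↦ T.maslov q.1 = T.maslov p.1 - 1),
      Finsupp.single q (T.sign p.1 q.1))

/-- The component of degree `k` of the boundary operator of `E`. -/
def boundaryAt (E : Finset T.contractible) (k : ℤ) :
    (level E k →₀ ℤ) →ₗ[ℤ] (level E (k - 1) →₀ ℤ) :=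
  Finsupp.linearCombination ℤ (fun p : level E k ↦
    ∑ q : level E (k - 1), Finsupp.single q (T.sign p.1 q.1))

/-- `E` is `∂`-complete if its boundary operator squares to zero. -/
def IsComplete (E : Finset T.contractible) : Prop :=
  boundary E ∘ₗ boundary E = 0

/-- The map of free abelian groups induced by an inclusion of finite sets. -/
def incl {D E : Finset T.contractible} (h : D ⊆ E) : (D →₀ ℤ) →ₗ[ℤ] (E →₀ ℤ) :=
  Finsupp.lmapDomain ℤ ℤ (fun p : D ↦ (⟨p.1, h p.2⟩ : E))

/-- The component of degree `k` of the map induced by an inclusion. -/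
def inclAt {D E : Finset T.contractible} (h : D ⊆ E) (k : ℤ) :
    (level D k →₀ ℤ) →ₗ[ℤ] (level E k →₀ ℤ) :=
  incl (level_mono h k)

/-- The pair `(D, E)` is chain compatible if the inclusion is a chain map. -/
def ChainCompatible {D E : Finset T.contractible} (h : D ⊆ E) : Prop :=
  ∀ k : ℤ, inclAt h (k - 1) ∘ₗ boundaryAt D k = boundaryAt E k ∘ₗ inclAt h k

end HomoclinicTangle

end HomFloer

end

namespace HomFloer.HomoclinicTangle

variable {M : Type*} [TopologicalSpace M] [ChartedSpace Plane M] [IsManifold (𝓡 2) ∞ M]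
  {T : HomoclinicTangle M}

/-! Both conditions are equalities of homomorphisms of free abelian groups, so they can be compared
entry by entry on generators `p ∈ D` and `q ∈ E`, where `μ(q) = μ(p) - 1`. At `q ∈ D` both sides of
the chain map equation have the same entry `n(p, q)`, because the sign does not depend on the
ambient finite set. At `q ∉ D` the side through `∂^D` has entry `0` and the other has `n(p, q)`.
Hence the equation fails exactly by the numbers `n(p, q)` with `q ∈ E \ D`, which are the entries of
the part of `∂^E` landing in `E \ D`, restricted to `D`. The lemmas `chainCompatible_iff` and
`boundaryPart_comp_incl_eq_zero_iff` reduce the two conditions to `NoBoundaryOutside`. -/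

/-- No generator of `D` has a point of `E \ D` in its boundary. -/
def NoBoundaryOutside (D E : Finset T.contractible) : Prop :=
  ∀ p ∈ D, ∀ q ∈ E, q ∉ D → T.maslov q = T.maslov p - 1 → T.sign p q = 0

theorem linearMap_eq_iff_single {α β : Type*} (f g : (α →₀ ℤ) →ₗ[ℤ] (β →₀ ℤ)) :
    f = g ↔ ∀ a b, f (Finsupp.single a 1) b = g (Finsupp.single a 1) b := by
  refine ⟨fun h a b ↦ by rw [h], fun h ↦ ?_⟩
  refine Finsupp.lhom_ext' fun a ↦ LinearMap.ext_ring ?_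
  ext b
  exact h a b

theorem incl_single {D E : Finset T.contractible} (h : D ⊆ E) (p : D) :
    incl h (Finsupp.single p 1) = Finsupp.single ⟨p.1, h p.2⟩ 1 :=
  Finsupp.mapDomain_single

theorem incl_injective_index {D E : Finset T.contractible} (h : D ⊆ E) :
    Function.Injective (fun p : D ↦ (⟨p.1, h p.2⟩ : E)) :=
  fun _ _ hpq ↦ Subtype.ext (congrArg (fun r : E ↦ r.1) hpq)

/-- By injectivity of the index map, no other generator contributes to the coefficient at `q`. -/
theorem incl_apply_of_mem {D E : Finset T.contractible} (h : D ⊆ E) (c : D →₀ ℤ) (q : E)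
    (hq : q.1 ∈ D) : incl h c q = c ⟨q.1, hq⟩ :=
  Finsupp.mapDomain_apply (incl_injective_index h) c ⟨q.1, hq⟩

theorem incl_apply_of_notMem {D E : Finset T.contractible} (h : D ⊆ E) (c : D →₀ ℤ) (q : E)
    (hq : q.1 ∉ D) : incl h c q = 0 := by
  refine Finsupp.mapDomain_of_notMem_range c q ?_
  rintro ⟨p, rfl⟩
  exact hq p.2

open Classical in
theorem boundaryPart_single_apply (E : Finset T.contractible) (F : Set T.contractible) (p q : E) :
    boundaryPart E F (Finsupp.single p 1) q =
      if q.1 ∈ F ∧ T.maslov q.1 = T.maslov p.1 - 1 then T.sign p.1 q.1 else 0 := by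
  rw [boundaryPart, Finsupp.linearCombination_single, one_smul, Finsupp.finsetSum_apply]
  simp only [Finsupp.single_apply, Finset.sum_ite_eq', Finset.mem_filter, Finset.mem_univ,
    true_and]

/-- Unlike in `boundaryPart_single_apply`, no case distinction occurs: the index types already fix
both degrees. -/
theorem boundaryAt_single_apply (E : Finset T.contractible) (k : ℤ) (p : level E k)
    (q : level E (k - 1)) : boundaryAt E k (Finsupp.single p 1) q = T.sign p.1 q.1 := by
  classical
  rw [boundaryAt, Finsupp.linearCombination_single, one_smul, Finsupp.finsetSum_apply]
  simp only [Finsupp.single_apply, Finset.sum_ite_eq', Finset.mem_univ, if_true]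

theorem boundaryPart_comp_incl_eq_zero_iff {D E : Finset T.contractible} (h : D ⊆ E) :
    boundaryPart E (↑E \ ↑D) ∘ₗ incl h = 0 ↔ NoBoundaryOutside D E := by
  rw [linearMap_eq_iff_single]
  simp only [LinearMap.comp_apply, incl_single, boundaryPart_single_apply, LinearMap.zero_apply,
    Finsupp.coe_zero, Pi.zero_apply, ite_eq_right_iff]
  constructor
  · intro H p hp q hq hqD hμ
    exact H ⟨p, hp⟩ ⟨q, hq⟩ ⟨⟨hq, hqD⟩, hμ⟩
  · rintro H p q ⟨⟨-, hqD⟩, hμ⟩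
    exact H p.1 p.2 q.1 q.2 hqD hμ

theorem mem_level {E : Finset T.contractible} {k : ℤ} {p : T.contractible} :
    p ∈ level E k ↔ p ∈ E ∧ T.maslov p = k :=
  Finset.mem_filter

/-- The two matrices can differ only in the entries at points `q` outside `D`, where the one
factoring through `ℤD` vanishes. -/
theorem chainCompatible_iff {D E : Finset T.contractible} (h : D ⊆ E) :
    ChainCompatible h ↔ NoBoundaryOutside D E := by
  simp only [ChainCompatible, linearMap_eq_iff_single, LinearMap.comp_apply, inclAt, incl_single,
    boundaryAt_single_apply]
  constructor
  · intro H p hp q hq hqD hμ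
    -- Only the degree `k = μ(p)` sees the generator `p`; then `hμ` puts `q` in the target level `k
    -- - 1`.
    have := H (T.maslov p) ⟨p, mem_level.2 ⟨hp, rfl⟩⟩ ⟨q, mem_level.2 ⟨hq, hμ⟩⟩
    rw [incl_apply_of_notMem _ _ _ fun hq' ↦ hqD (mem_level.1 hq').1] at this
    exact this.symm
  · intro H k p q
    obtain ⟨hpD, hpk⟩ := mem_level.1 p.2
    obtain ⟨hqE, hqk⟩ := mem_level.1 q.2
    by_cases hqD : q.1 ∈ D
    -- Here both entries are the same sign `n(p, q)`.
    · rw [incl_apply_of_mem _ _ _ (mem_level.2 ⟨hqD, hqk⟩), boundaryAt_single_apply]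
    -- Here the left entry is `0`, and the right one vanishes by `H`, whose degree condition is
    -- recovered from the two levels.
    · rw [incl_apply_of_notMem _ _ _ fun hq' ↦ hqD (mem_level.1 hq').1,
        H p.1 hpD q.1 hqE hqD (by rw [hqk, hpk])]

end HomFloer.HomoclinicTangle

theorem mainTheorem6 {M : Type*} [TopologicalSpace M] [T2Space M] [ChartedSpace HomFloer.Plane M]
    [IsManifold (𝓡 2) ∞ M] (hM : HomFloer.IsPlaneOrClosedSurface M)
    (T : HomFloer.HomoclinicTangle M) (D E : Finset T.contractible)
    (hD : HomFloer.HomoclinicTangle.IsComplete D) (hE : HomFloer.HomoclinicTangle.IsComplete E)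
    (hDE : D ⊆ E) :
    (HomFloer.HomoclinicTangle.ChainCompatible hDE ↔
      HomFloer.HomoclinicTangle.boundaryPart E (↑E \ ↑D) ∘ₗ
        HomFloer.HomoclinicTangle.incl hDE = 0) ∧
    (HomFloer.HomoclinicTangle.ChainCompatible hDE ↔
      ¬ ∃ p ∈ D, ∃ q ∈ E, q ∉ D ∧ T.maslov q = T.maslov p - 1 ∧ T.sign p q ≠ 0) := by
  rw [HomFloer.HomoclinicTangle.boundaryPart_comp_incl_eq_zero_iff,
    HomFloer.HomoclinicTangle.chainCompatible_iff]
  refine ⟨Iff.rfl, ?_⟩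
  rw [HomFloer.HomoclinicTangle.NoBoundaryOutside]
  -- Moving the negation inwards turns the excluded pair into the implications of
  -- `NoBoundaryOutside`.
  push Not
  rfl
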